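/- Let $X$ be a real locally convex topological vector space with topological dual $X^*$, where $X^*$ carries any locally convex vector topology compatible with the duality (that is, its continuous linear functionals are exactly the evaluations $x^*\mapsto\langle x^*,x\rangle$, $x\in X$; for instance the weak-$*$ topology). Let $T$ be an arbitrary set and let $f_t:X\to\overline{\mathbb R}=\mathbb R\cup\{\pm\infty\}$, $t\in T$, be convex functions (i.e. their epigraphs are convex subsets of $X\times\mathbb R$). Put $f:=\sup_{t\in T}f_t$ and suppose that $f$ is continuous at some point of $[f<0]\cap f^{-1}(\mathbb R)$. Notation. For $g:X\to\overline{\mathbb R}$, $\operatorname{dom} g=\{y: g(y)<+\infty\}$; $\bar g$ is the function whose epigraph is the closure of the epigraph of $g$; $g$ is proper if $\operatorname{dom}g\ne\emptyset$ and $g>-\infty$ everywhere. For $\varepsilon\ge 0$, $\partial_\varepsilon g(x)=\{x^*\in X^*:\langle x^*,y-x\rangle\le g(y)-g(x)+\varepsilon\ \forall y\in X\}$ if $g(x)\in\mathbb R$, and $\partial_\varepsilon g(x)=\emptyset$ otherwise. For $A\subset X$, $\mathrm N^\varepsilon_A(x)=\partial_\varepsilon \mathrm I_A(x)$, where $\mathrm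 I_A$ is $0$ on $A$ and $+\infty$ off $A$, and $\mathrm N_A(x)=\mathrm N_A^0(x)$. For a nonempty closed convex set $A$, $[A]_\infty=\bigcap_{t>0}t(A-a)$ for any $a\in A$, and $[\emptyset]_\infty=\{0\}$. Further, $\overline{\operatorname{co}}$ denotes the closed convex hull (in $X^*$), $\mathcal P=\{t\in T:\bar f_t \text{ is proper}\}$ and, for $\varepsilon,s>0$, $T_{\varepsilon/s}(x)=\{t\in\mathcal P: s f_t(x)\ge-\varepsilon\}$. Then, for every $x\in[f\le 0]$ such that $f(x)\in\mathbb R$, $$\mathrm N_{\operatorname{cl}([f<0])}(x)=\left[\overline{\operatorname{co}}\left(\Big(\bigcup_{s>0,\ t\in T_{\varepsilon/s}(x)}\partial_\varepsilon(sf_t)(x)\Big)\cup\Big(\bigcup_{t\in T\setminus\mathcal P}\mathrm N^{\varepsilon}_{\operatorname{dom}f_t}(x)\Big)\right)\right]_\infty\quad\text{for all }\varepsilon>0,$$ and $$\mathrm N_{\operatorname{cl}([f<0])}(x)=\bigcap_{\varepsilon>0}\overline{\operatorname{co}}\left(\Big(\bigcup_{s>0,\ t\in T_{\varepsilon/s}(x)}\partial_\varepsilon(sf_t)(x)\Big)\cup\Big(\bigcup_{t\in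 T\setminus\mathcal P}\mathrm N^{\varepsilon}_{\operatorname{dom}f_t}(x)\Big)\right).$$ -/

import Mathlib

open Set Topology
open scoped Pointwise

namespace SublevelCone

/-- The epigraph `{(x, c) | f x ≤ c}` of an extended real valued function, as a subset of `X × ℝ`. -/
def epi {X : Type*} (f : X → EReal) : Set (X × ℝ) :=
  {p | f p.1 ≤ (p.2 : EReal)}

/-- The effective domain. -/
def effDom {X : Type*} (f : X → EReal) : Set X :=
  {x | f x < ⊤}

/-- A function is convex if its epigraph is a convex set. -/
def IsConvexFun {X : Type*} [AddCommGroup X] [Module ℝ X] (f : X → EReal) : Prop :=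
  Convex ℝ (epi f)

/-- A function is proper if its domain is nonempty and it never takes the value `-∞`. -/
def IsProper {X : Type*} (f : X → EReal) : Prop :=
  (effDom f).Nonempty ∧ ∀ x, f x ≠ ⊥

/-- The closed (lower semicontinuous) hull of `f`: the function whose epigraph is the closure of
the epigraph of `f` (see `epi_closedHull`). -/
noncomputable def closedHull {X : Type*} [TopologicalSpace X] (f : X → EReal) (x : X) : EReal :=
  ⨅ (c : ℝ) (_ : (x, c) ∈ closure (epi f)), (c : EReal)

theorem closure_epi_mono {X : Type*} [TopologicalSpace X] (f : X → EReal) {x : X} {c d : ℝ}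
    (h : (x, c) ∈ closure (epi f)) (hcd : c ≤ d) : (x, d) ∈ closure (epi f) := by
  have hcont : Continuous (fun p : X × ℝ => (p.1, p.2 + (d - c))) := by fun_prop
  have hmaps : MapsTo (fun p : X × ℝ => (p.1, p.2 + (d - c))) (epi f) (epi f) := by
    intro p hp
    have hp' : f p.1 ≤ (p.2 : EReal) := hp
    show f p.1 ≤ ((p.2 + (d - c) : ℝ) : EReal)
    exact hp'.trans (EReal.coe_le_coe_iff.2 (by linarith))
  have := hmaps.closure hcont h
  simpa using this

theorem epi_closedHull {X : Type*} [TopologicalSpace X] (f : X → EReal) :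
    epi (closedHull f) = closure (epi f) := by
  ext ⟨x, c⟩
  constructor
  · intro h
    have h' : closedHull f x ≤ (c : EReal) := h
    have key : ∀ d : ℝ, c < d → (x, d) ∈ closure (epi f) := by
      intro d hd
      have hlt : closedHull f x < (d : EReal) := h'.trans_lt (EReal.coe_lt_coe_iff.2 hd)
      simp only [closedHull, iInf_lt_iff] at hlt
      obtain ⟨e, he, hed⟩ := hlt
      exact closure_epi_mono f he (EReal.coe_lt_coe_iff.1 hed).le
    have hclosed : IsClosed {d : ℝ | (x, d) ∈ closure (epi f)} :=
      isClosed_closure.preimage (by fun_prop : Continuous fun d : ℝ => (x, d))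
    have hsub : closure (Ioi c) ⊆ {d : ℝ | (x, d) ∈ closure (epi f)} :=
      hclosed.closure_subset_iff.2 (fun d hd => key d hd)
    rw [closure_Ioi] at hsub
    exact hsub self_mem_Ici
  · intro h
    exact iInf₂_le (f := fun (c : ℝ) (_ : (x, c) ∈ closure (epi f)) => (c : EReal)) c h

/-- The indicator function `I_A`, equal to `0` on `A` and to `+∞` off `A`. -/
noncomputable def indicatorFun {X : Type*} (A : Set X) (x : X) : EReal :=
  open Classical in if x ∈ A then 0 else ⊤

/-- The `ε`-subdifferential of `f` at `x`; it is empty unless `f x` is finite. -/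
def epsSubdiff {X : Type*} [AddCommGroup X] [Module ℝ X] [TopologicalSpace X]
    (ε : ℝ) (f : X → EReal) (x : X) : Set (StrongDual ℝ X) :=
  {φ | f x ≠ ⊥ ∧ f x ≠ ⊤ ∧ ∀ y, ((φ (y - x) : ℝ) : EReal) ≤ f y - f x + (ε : EReal)}

/-- The `ε`-normal set to `A` at `x`, i.e. the `ε`-subdifferential of the indicator function. -/
noncomputable def epsNormal {X : Type*} [AddCommGroup X] [Module ℝ X] [TopologicalSpace X]
    (ε : ℝ) (A : Set X) (x : X) : Set (StrongDual ℝ X) :=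
  epsSubdiff ε (indicatorFun A) x

/-- The normal cone to `A` at `x`. -/
noncomputable def normalCone {X : Type*} [AddCommGroup X] [Module ℝ X] [TopologicalSpace X]
    (A : Set X) (x : X) : Set (StrongDual ℝ X) :=
  epsNormal 0 A x

/-- The recession cone `⋂ t > 0, t (A - a)` of a nonempty closed convex set `A`, which does not
depend on the choice of `a ∈ A`; by convention the recession cone of `∅` is `{0}`. -/
def recessionCone {E : Type*} [AddCommGroup E] [Module ℝ E] (A : Set E) : Set E :=
  {d | (A = ∅ → d = 0) ∧ ∀ a ∈ A, ∀ t : ℝ, 0 < t → d ∈ t • (A - {a})}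

/-- The topology `τ` on the dual `X*` is compatible with the duality between `X` and `X*`: it is a
locally convex vector space topology for which the continuous linear functionals are exactly
the evaluations at the points of `X`. -/
structure IsCompatibleTopology {X : Type*} [AddCommGroup X] [Module ℝ X] [TopologicalSpace X]
    (τ : TopologicalSpace (StrongDual ℝ X)) : Prop where
  isTopologicalAddGroup : @IsTopologicalAddGroup (StrongDual ℝ X) τ _
  continuousSMul : @ContinuousSMul ℝ (StrongDual ℝ X) _ _ τ
  locallyConvexSpace : @LocallyConvexSpace ℝ (StrongDual ℝ X) _ _ _ _ τ
  continuous_iff : ∀ Φ : StrongDual ℝ X →ₗ[ℝ] ℝ,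
    Continuous[τ, inferInstance] Φ ↔ ∃ x : X, ∀ φ : StrongDual ℝ X, Φ φ = φ x

section Family

variable {X T : Type*} [AddCommGroup X] [Module ℝ X] [TopologicalSpace X]

/-- The pointwise supremum `sup_t f_t`. -/
noncomputable def supFun (f : T → X → EReal) (x : X) : EReal :=
  ⨆ t, f t x

/-- The indices `t` for which the closed hull of `f t` is proper. -/
def properIdx (f : T → X → EReal) : Set T :=
  {t | IsProper (closedHull (f t))}

/-- The index set `T_{ε/s}(x)`: the `t` with proper closed hull and `s f_t(x) ≥ -ε`. -/
def activeIdx (f : T → X → EReal) (x : X) (ε s : ℝ) : Set T :=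
  {t | t ∈ properIdx f ∧ ((-ε : ℝ) : EReal) ≤ (s : EReal) * f t x}

/-- The union, over `s > 0` and `t ∈ T_{ε/s}(x)`, of the `ε`-subdifferentials of `s f_t` at `x`,
together with the `ε`-normal sets at `x` to the domains of the `f t` with nonproper closed hull. -/
def generators (f : T → X → EReal) (x : X) (ε : ℝ) : Set (StrongDual ℝ X) :=
  (⋃ (s : ℝ) (_ : 0 < s) (t ∈ activeIdx f x ε s),
      epsSubdiff ε (fun y => (s : EReal) * f t y) x) ∪
    ⋃ t ∈ (properIdx f)ᶜ, epsNormal ε (effDom (f t)) x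

end Family

end SublevelCone

namespace SublevelCone

/-! ### Closed epigraphs and affine minorants -/

section Epigraph

variable {X : Type*} [AddCommGroup X] [Module ℝ X] [TopologicalSpace X]

/-! Let `C` be the closure of `[f < 0]` and `K ε` the closed convex hull of the generators.
Everything follows from two facts: each `φ ∈ K ε` satisfies `φ (y - x) ≤ 2ε` on `C`
(`closure_convexHull_generators_subset`), and the normal cone lies in `K ε`
(`normalCone_subset_closure_convexHull_generators`). Letting `ε → 0` gives the intersection formula;
scaling gives the recession formula, the normal cone being a cone containing `0`.

The second fact is dual. A τ-continuous functional is evaluation at some `z`. If the generators are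
at most `M` at `z`, then `x + l • z ∈ C` for small `l > 0`, so normals are nonpositive at `z`, while
`0 ≤ M`. Indeed, if `(x + l • z, 0)` were outside some closed epigraph, a separating affine minorant
(or a functional separating from the domain, in the nonproper case), rescaled, would be a generator
exceeding `M` at `z`. The Slater point brings the closed hulls back to `C` (`mem_closure_sublevel`).
-/

theorem mem_epi {X : Type*} {f : X → EReal} {x : X} {c : ℝ} :
    (x, c) ∈ epi f ↔ f x ≤ (c : EReal) := Iff.rfl

/-- A functional on `X × ℝ` bounded above on the closure of a nonempty epigraph is nonincreasing in
the vertical direction. -/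
theorem vertical_nonpos_of_lt {f : X → EReal} {F : StrongDual ℝ (X × ℝ)} {u : ℝ} {w : X} {r : ℝ}
    (hw : (w, r) ∈ closure (epi f)) (hF : ∀ p ∈ closure (epi f), F p < u) : F (0, 1) ≤ 0 := by
  by_contra! h
  have hd : 0 ≤ max 0 ((u - F (w, r)) / F (0, 1)) := le_max_left _ _
  have hmem := hF _ (closure_epi_mono f hw (le_add_of_nonneg_right hd))
  have hsplit : ∀ d : ℝ, F (w, r + d) = F (w, r) + d * F (0, 1) := by
    intro d
    rw [← smul_eq_mul, ← map_smul, ← map_add]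
    simp
  rw [hsplit] at hmem
  have h1 := le_max_right 0 ((u - F (w, r)) / F (0, 1))
  rw [div_le_iff₀ h] at h1
  linarith

theorem apply_prod (F : StrongDual ℝ (X × ℝ)) (y : X) (r : ℝ) :
    F (y, r) = F.comp (ContinuousLinearMap.inl ℝ X ℝ) y + r * F (0, 1) := by
  rw [← smul_eq_mul, ← map_smul, ContinuousLinearMap.comp_apply, ← map_add]
  simp

/-- A non-vertical strictly separating functional yields an affine minorant. -/
theorem affine_minorant_of_neg {f : X → EReal} {F : StrongDual ℝ (X × ℝ)} {u : ℝ}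
    (hF : ∀ p ∈ closure (epi f), F p < u) (hneg : F (0, 1) < 0) {p : X} {v : ℝ}
    (hp : u < F (p, v)) :
    ∃ (ψ : StrongDual ℝ X) (c : ℝ), (∀ y r, (y, r) ∈ closure (epi f) → ψ y + c ≤ r) ∧
      v < ψ p + c := by
  set κ := F (0, 1) with hκ
  refine ⟨(-κ)⁻¹ • F.comp (ContinuousLinearMap.inl ℝ X ℝ), -((-κ)⁻¹ * u), ?_, ?_⟩
  · intro y r hy
    have h := hF _ hy
    rw [apply_prod, ← hκ] at h
    simp only [smul_apply, smul_eq_mul]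
    rw [← sub_eq_add_neg, ← mul_sub, inv_mul_le_iff₀ (by linarith)]
    linarith
  · rw [apply_prod, ← hκ] at hp
    simp only [smul_apply, smul_eq_mul]
    rw [← sub_eq_add_neg, ← mul_sub, lt_inv_mul_iff₀ (by linarith)]
    linarith

variable [IsTopologicalAddGroup X] [ContinuousSMul ℝ X]

/-- If the closed hull of a convex function takes the value `-∞`, the closure of the epigraph
contains the vertical lines over the closure of the domain. -/
theorem mem_closure_epi_of_not_isProper {f : X → EReal} (hf : IsConvexFun f)
    (hp : ¬ IsProper (closedHull f)) {y : X} (hy : y ∈ closure (effDom f)) (c : ℝ) :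
    (y, c) ∈ closure (epi f) := by
  have hdom : ∀ y ∈ effDom f, ∃ r : ℝ, (y, r) ∈ closure (epi f) := by
    intro y hy
    have hy' : f y < ⊤ := hy
    obtain ⟨r, hr, -⟩ := EReal.lt_iff_exists_real_btwn.1 hy'
    exact ⟨r, subset_closure (mem_epi.2 hr.le)⟩
  have hne : (effDom f).Nonempty := closure_nonempty_iff.1 ⟨y, hy⟩
  obtain ⟨w, hw⟩ : ∃ w, closedHull f w = ⊥ := by
    by_contra! h
    obtain ⟨y₀, hy₀⟩ := hne
    obtain ⟨r, hr⟩ := hdom y₀ hy₀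
    rw [← epi_closedHull] at hr
    exact hp ⟨⟨y₀, lt_of_le_of_lt hr (EReal.coe_lt_top r)⟩, h⟩
  have hw' : ∀ v : ℝ, (w, v) ∈ closure (epi f) := by
    intro v
    rw [← epi_closedHull, mem_epi, hw]
    exact bot_le
  have hclosed : IsClosed {y : X | (y, c) ∈ closure (epi f)} :=
    isClosed_closure.preimage (by fun_prop : Continuous fun y : X => (y, c))
  refine hclosed.closure_subset_iff.2 (fun y' hy' => ?_) hy
  obtain ⟨r, hr⟩ := hdom y' hy'
  have hlim : Filter.Tendsto (fun μ : ℝ => ((1 - μ) • y' + μ • w, c)) (𝓝[>] 0)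
      (𝓝 (y', c)) := by
    have hc : Continuous (fun μ : ℝ => ((1 - μ) • y' + μ • w, c)) := by fun_prop
    have := (hc.tendsto 0).mono_left (nhdsWithin_le_nhds (s := Ioi 0))
    simpa using this
  refine isClosed_closure.mem_of_tendsto hlim ?_
  filter_upwards [Ioo_mem_nhdsGT (zero_lt_one : (0 : ℝ) < 1)] with μ hμ
  -- The height over `w` is chosen so that the combination has height exactly `c`.
  have := Convex.closure hf hr (hw' ((c - (1 - μ) * r) / μ)) (sub_nonneg.2 hμ.2.le) hμ.1.le
    (sub_add_cancel 1 μ)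
  have hμ0 := hμ.1.ne'
  simp only [Prod.smul_mk, Prod.mk_add_mk, smul_eq_mul] at this
  rwa [mul_div_cancel₀ _ hμ0, add_sub_cancel] at this

variable [LocallyConvexSpace ℝ X]

/-- A convex function with proper closed hull has a continuous affine minorant. -/
theorem exists_affine_minorant {f : X → EReal} (hf : IsConvexFun f)
    (hp : IsProper (closedHull f)) :
    ∃ (ψ : StrongDual ℝ X) (c : ℝ), ∀ y r, (y, r) ∈ closure (epi f) → ψ y + c ≤ r := by
  obtain ⟨⟨w, hw⟩, hbot⟩ := hp
  obtain ⟨r, hr⟩ : ∃ r : ℝ, (w, r) ∈ closure (epi f) := by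
    have hw' : closedHull f w < ⊤ := hw
    simp only [closedHull, iInf_lt_iff] at hw'
    obtain ⟨r, hr, -⟩ := hw'
    exact ⟨r, hr⟩
  obtain ⟨v, hv⟩ : ∃ v : ℝ, (w, v) ∉ closure (epi f) := by
    by_contra! h
    refine hbot w ((EReal.eq_bot_iff_forall_lt _).2 fun v => ?_)
    refine lt_of_le_of_lt ?_ (EReal.coe_lt_coe_iff.2 (sub_one_lt v))
    rw [← mem_epi, epi_closedHull]
    exact h _
  obtain ⟨F, u, hF, hu⟩ :=
    geometric_hahn_banach_closed_point (Convex.closure hf) isClosed_closure hv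
  have hrv : v < r := by
    by_contra! h
    exact hv (closure_epi_mono f hr h)
  have h1 := (hF _ hr).trans hu
  rw [apply_prod F w r, apply_prod F w v] at h1
  have hneg : F (0, 1) < 0 := by
    by_contra! h
    nlinarith
  obtain ⟨ψ, c, h, -⟩ := affine_minorant_of_neg hF hneg hu
  exact ⟨ψ, c, h⟩

/-- The closed hull of a convex function, when proper, is the supremum of the continuous affine
minorants. -/
theorem exists_affine_minorant_gt {f : X → EReal} (hf : IsConvexFun f)
    (hp : IsProper (closedHull f)) {p : X} {v : ℝ} (hv : (p, v) ∉ closure (epi f)) :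
    ∃ (ψ : StrongDual ℝ X) (c : ℝ), (∀ y r, (y, r) ∈ closure (epi f) → ψ y + c ≤ r) ∧
      v < ψ p + c := by
  obtain ⟨ψ₀, c₀, h₀⟩ := exists_affine_minorant hf hp
  obtain ⟨w, hw⟩ := hp.1
  have hw' : closedHull f w < ⊤ := hw
  simp only [closedHull, iInf_lt_iff] at hw'
  obtain ⟨r, hr, -⟩ := hw'
  obtain ⟨F, u, hF, hu⟩ :=
    geometric_hahn_banach_closed_point (Convex.closure hf) isClosed_closure hv
  rcases (vertical_nonpos_of_lt hr hF).lt_or_eq with hneg | hzero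
  · exact affine_minorant_of_neg hF hneg hu
  -- Vertical separation: `ψ - u` is negative on the domain and positive at `p`, so adding a large
  -- multiple `N` of it to any affine minorant lifts the value at `p` above `v`.
  · set ψ := F.comp (ContinuousLinearMap.inl ℝ X ℝ) with hψ
    have hF' : ∀ y r, F (y, r) = ψ y := fun y r => by rw [apply_prod, hzero, mul_zero, add_zero]
    rw [hF'] at hu
    have hpos : 0 < ψ p - u := by linarith
    set N := max 0 ((v - (ψ₀ p + c₀)) / (ψ p - u) + 1) with hN
    have hN0 : 0 ≤ N := le_max_left _ _
    have hN1 : (v - (ψ₀ p + c₀)) / (ψ p - u) < N :=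
      (lt_add_one _).trans_le (le_max_right _ _)
    rw [div_lt_iff₀ hpos] at hN1
    refine ⟨ψ₀ + N • ψ, c₀ - N * u, fun y r hy => ?_, ?_⟩
    · have h1 := hF _ hy
      rw [hF'] at h1
      have h2 := h₀ y r hy
      have h3 := mul_nonneg hN0 (sub_nonneg.2 h1.le)
      simp only [add_apply, smul_apply, smul_eq_mul]
      linarith
    · simp only [add_apply, smul_apply, smul_eq_mul]
      linarith

end Epigraph

/-! ### Approximate normals and subgradients -/

section Normal

variable {X : Type*} [AddCommGroup X] [Module ℝ X] [TopologicalSpace X]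

theorem mem_epsNormal {ε : ℝ} {A : Set X} {x : X} {φ : StrongDual ℝ X} :
    φ ∈ epsNormal ε A x ↔ x ∈ A ∧ ∀ y ∈ A, φ (y - x) ≤ ε := by
  by_cases hx : x ∈ A
  · have h0 : indicatorFun A x = 0 := if_pos hx
    simp only [epsNormal, epsSubdiff, mem_ofPred_eq, h0, hx, true_and, sub_zero]
    refine ⟨fun h y hy => ?_, fun h => ⟨EReal.zero_ne_bot, EReal.zero_ne_top, fun y => ?_⟩⟩
    · have h1 := h.2.2 y
      rw [indicatorFun, if_pos hy, zero_add] at h1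
      exact EReal.coe_le_coe_iff.1 h1
    · by_cases hy : y ∈ A
      · rw [indicatorFun, if_pos hy, zero_add]
        exact EReal.coe_le_coe_iff.2 (h y hy)
      · rw [indicatorFun, if_neg hy, EReal.top_add_coe]
        exact le_top
  · have h0 : indicatorFun A x = ⊤ := if_neg hx
    simp [epsNormal, epsSubdiff, h0, hx]

theorem mem_normalCone {A : Set X} {x : X} {φ : StrongDual ℝ X} :
    φ ∈ normalCone A x ↔ x ∈ A ∧ ∀ y ∈ A, φ (y - x) ≤ 0 :=
  mem_epsNormal

/-- The scaling of an affine minorant of `f` lies in the `ε`-subdifferential of the scaled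
function, if the gap at the point is at most `ε`. -/
theorem smul_mem_epsSubdiff {f : X → EReal} {x : X} {a : ℝ} (ha : f x = a) {ψ : StrongDual ℝ X}
    {c s ε : ℝ} (hs : 0 < s) (hψ : ∀ y r, (y, r) ∈ epi f → ψ (y - x) + c ≤ r)
    (hgap : s * (a - c) ≤ ε) : s • ψ ∈ epsSubdiff ε (fun y => (s : EReal) * f y) x := by
  have hsa : (s : EReal) * f x = ((s * a : ℝ) : EReal) := by rw [ha, EReal.coe_mul]
  refine ⟨hsa.trans_ne (EReal.coe_ne_bot _), hsa.trans_ne (EReal.coe_ne_top _),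
    fun y => ?_⟩
  simp only [hsa, smul_apply, smul_eq_mul]
  induction hy : f y with
  | bot =>
    exfalso
    have h := hψ y (ψ (y - x) + c - 1) (by rw [mem_epi, hy]; exact bot_le)
    linarith
  | top =>
    rw [EReal.coe_mul_top_of_pos hs, EReal.top_sub_coe, EReal.top_add_coe]
    exact le_top
  | coe r =>
    have h := hψ y r (by rw [mem_epi, hy])
    rw [← EReal.coe_mul, ← EReal.coe_sub, ← EReal.coe_add, EReal.coe_le_coe_iff]
    have := mul_le_mul_of_nonneg_left h hs.le
    linarith

end Normal

/-! ### Recession cones and separation in the dual -/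

section Recession

variable {E : Type*} [AddCommGroup E] [Module ℝ E]

theorem recessionCone_of_nonempty {A : Set E} (hA : A.Nonempty) {d : E} :
    d ∈ recessionCone A ↔ ∀ a ∈ A, ∀ t : ℝ, 0 < t → a + t • d ∈ A := by
  have key : ∀ (a : E) (t : ℝ), 0 < t → (d ∈ t • (A - {a}) ↔ a + t⁻¹ • d ∈ A) := by
    intro a t ht
    rw [mem_smul_set_iff_inv_smul_mem₀ ht.ne', sub_singleton, mem_image]
    constructor
    · rintro ⟨b, hb, h⟩
      rwa [← h, add_sub_cancel]
    · exact fun h => ⟨_, h, add_sub_cancel_left _ _⟩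
  constructor
  · intro h a ha t ht
    simpa using (key a t⁻¹ (inv_pos.2 ht)).1 (h.2 a ha _ (inv_pos.2 ht))
  · exact fun h => ⟨fun h0 => absurd h0 hA.ne_empty,
      fun a ha t ht => (key a t ht).2 (h a ha _ (inv_pos.2 ht))⟩

/-- `a + t • d` is the limit of `(1 - μ) • a + μ • ((t / μ) • d)` as `μ → 0`, and `(t / μ) • d`
stays in the cone. -/
theorem subset_recessionCone_of_cone [TopologicalSpace E] [IsTopologicalAddGroup E]
    [ContinuousSMul ℝ E] {A K : Set E} (hconv : Convex ℝ A)
    (hA : (closure A).Nonempty) (hKA : K ⊆ closure A)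
    (hK : ∀ d ∈ K, ∀ t : ℝ, 0 < t → t • d ∈ K) : K ⊆ recessionCone (closure A) := by
  intro d hd
  rw [recessionCone_of_nonempty hA]
  intro a ha t ht
  have hlim : Filter.Tendsto (fun μ : ℝ => (1 - μ) • a + t • d) (𝓝[>] 0) (𝓝 (a + t • d)) := by
    have hc : Continuous (fun μ : ℝ => (1 - μ) • a + t • d) := by fun_prop
    have := (hc.tendsto 0).mono_left (nhdsWithin_le_nhds (s := Ioi 0))
    simpa using this
  refine isClosed_closure.mem_of_tendsto hlim ?_
  filter_upwards [Ioo_mem_nhdsGT (zero_lt_one : (0 : ℝ) < 1)] with μ hμ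
  have := hconv.closure ha (hKA (hK d hd (t / μ) (div_pos ht hμ.1))) (sub_nonneg.2 hμ.2.le) hμ.1.le
    (sub_add_cancel 1 μ)
  rwa [smul_smul, mul_div_cancel₀ _ hμ.1.ne'] at this

theorem mem_closure_convexHull_of_forall_dual [TopologicalSpace E] [IsTopologicalAddGroup E]
    [ContinuousSMul ℝ E] [LocallyConvexSpace ℝ E] {S : Set E} {e : E}
    (h : ∀ (Φ : E →ₗ[ℝ] ℝ), Continuous Φ → ∀ M : ℝ, (∀ d ∈ S, Φ d ≤ M) → Φ e ≤ M) :
    e ∈ closure (convexHull ℝ S) := by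
  by_contra he
  obtain ⟨Φ, u, hΦ, hu⟩ :=
    geometric_hahn_banach_closed_point (convex_convexHull ℝ S).closure isClosed_closure he
  exact hu.not_ge (h (Φ : E →ₗ[ℝ] ℝ) Φ.continuous u fun d hd =>
    (hΦ d (subset_closure (subset_convexHull ℝ S hd))).le)

end Recession

/-! ### Generators versus normals to the sublevel set -/

section Sublevel

variable {X T : Type*} [AddCommGroup X] [Module ℝ X] [TopologicalSpace X]

/-- One `ε` comes from the subdifferential, the other from `s * f t x ≥ -ε`. The bound passes to the
closed hull because evaluation at `y - x` is τ-continuous. -/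
theorem closure_convexHull_generators_subset {τ : TopologicalSpace (StrongDual ℝ X)}
    (hτ : IsCompatibleTopology τ) {f : T → X → EReal} {x : X} {ε : ℝ} (hε : 0 ≤ ε)
    {φ : StrongDual ℝ X} (hφ : φ ∈ closure[τ] (convexHull ℝ (generators f x ε))) :
    ∀ y ∈ closure {y | supFun f y < 0}, φ (y - x) ≤ 2 * ε := by
  have hle : ∀ y t, supFun f y < 0 → f t y ≤ 0 := fun y t hy =>
    (le_iSup (fun t => f t y) t).trans hy.le
  have hgen : ∀ ψ ∈ generators f x ε, ∀ y ∈ closure {y | supFun f y < 0},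
      ψ (y - x) ≤ 2 * ε := by
    intro ψ hψ
    have hclosed : IsClosed {y : X | ψ y - ψ x ≤ 2 * ε} :=
      isClosed_le (by fun_prop) continuous_const
    have hsub : {y | supFun f y < 0} ⊆ {y : X | ψ y - ψ x ≤ 2 * ε} := by
      intro y hy
      show ψ y - ψ x ≤ 2 * ε
      rw [← map_sub]
      rcases hψ with hψ | hψ
      · simp only [mem_iUnion] at hψ
        obtain ⟨s, hs, t, ht, hbot, htop, hψ⟩ := hψ
        have hy0 : (s : EReal) * f t y ≤ 0 :=
          EReal.mul_nonpos_iff.2 (Or.inl ⟨EReal.coe_nonneg.2 hs.le, hle y t hy⟩)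
        have hact := ht.2
        have h1 := hψ y
        lift (s : EReal) * f t x to ℝ using ⟨htop, hbot⟩ with b
        have h2 : ((ψ (y - x) : ℝ) : EReal) ≤ ((0 - b + ε : ℝ) : EReal) := by
          refine h1.trans ?_
          rw [EReal.coe_add, EReal.coe_sub, EReal.coe_zero]
          gcongr
          exact EReal.sub_le_sub hy0 le_rfl
        rw [EReal.coe_le_coe_iff] at h2 hact
        linarith
      · simp only [mem_iUnion] at hψ
        obtain ⟨t, -, hψ⟩ := hψ
        have := (mem_epsNormal.1 hψ).2 y
          (lt_of_le_of_lt (hle y t hy) EReal.zero_lt_top)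
        linarith
    intro y hy
    rw [map_sub]
    exact hclosed.closure_subset_iff.2 hsub hy
  intro y hy
  let Φ : StrongDual ℝ X →ₗ[ℝ] ℝ :=
    { toFun := fun ψ => ψ (y - x), map_add' := fun _ _ => rfl, map_smul' := fun _ _ => rfl }
  have hΦ : Continuous[τ, inferInstance] Φ := (hτ.continuous_iff Φ).2 ⟨y - x, fun _ => rfl⟩
  have hconv : Convex ℝ (Φ ⁻¹' Iic (2 * ε)) := (convex_Iic _).linear_preimage Φ
  have hcl : IsClosed[τ] (Φ ⁻¹' Iic (2 * ε)) := @IsClosed.preimage _ _ τ _ _ hΦ _ isClosed_Iic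
  have hmin : convexHull ℝ (generators f x ε) ⊆ Φ ⁻¹' Iic (2 * ε) :=
    convexHull_min (fun ψ hψ => hgen ψ hψ y hy) hconv
  exact (@IsClosed.closure_subset_iff _ τ _ _ hcl).2 hmin hφ

/-- Small multiples of an affine minorant of one of the functions are generators. -/
theorem smul_mem_generators {f : T → X → EReal} {x : X} (hx : supFun f x ≤ 0) {t : T}
    (ht : t ∈ properIdx f) {ψ : StrongDual ℝ X} {c s ε : ℝ}
    (hψ : ∀ y r, (y, r) ∈ closure (epi (f t)) → ψ y + c ≤ r) (hs : 0 < s)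
    (hsc : s * (-(ψ x + c)) ≤ ε) : s • ψ ∈ generators f x ε := by
  have hft : f t x ≤ 0 := (le_iSup (fun t => f t x) t).trans hx
  have hbot : f t x ≠ ⊥ := by
    intro h
    have := hψ x (ψ x + c - 1) (subset_closure (by rw [mem_epi, h]; exact bot_le))
    linarith
  obtain ⟨a, ha⟩ : ∃ a : ℝ, f t x = a :=
    ⟨_, (EReal.coe_toReal (hft.trans_lt EReal.zero_lt_top).ne hbot).symm⟩
  have ha0 : a ≤ 0 := by
    rw [ha] at hft
    exact EReal.coe_nonpos.1 hft
  have hca : ψ x + c ≤ a := hψ x a (subset_closure (by rw [mem_epi, ha]))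
  -- The bound `-ε ≤ s * (ψ x + c)` serves twice: it makes `t` active and, since `a ≤ 0`, keeps the
  -- gap at most `ε`.
  have h1 := mul_le_mul_of_nonneg_left hca hs.le
  have h2 := mul_nonpos_of_nonneg_of_nonpos hs.le ha0
  left
  simp only [mem_iUnion]
  refine ⟨s, hs, t, ⟨ht, ?_⟩, smul_mem_epsSubdiff ha (c := ψ x + c) hs (fun y r hy => ?_) ?_⟩
  · rw [ha, ← EReal.coe_mul, EReal.coe_le_coe_iff]
    linarith
  · have := hψ y r (subset_closure hy)
    rw [map_sub]
    linarith
  · linarith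

variable [IsTopologicalAddGroup X] [ContinuousSMul ℝ X]

/-- Under the Slater type condition, the closed strict sublevel set contains every point that lies
in the nonpositive sublevel sets of all the closed hulls. -/
theorem mem_closure_sublevel {f : T → X → EReal} (hf : ∀ t, IsConvexFun (f t)) {x₀ : X}
    (h0 : supFun f x₀ < 0) (hcont : ContinuousAt (supFun f) x₀) {y : X}
    (hy : ∀ t, (y, (0 : ℝ)) ∈ closure (epi (f t))) : y ∈ closure {y | supFun f y < 0} := by
  obtain ⟨b, hb, hb0⟩ := EReal.lt_iff_exists_real_btwn.1 h0
  have hb0' : b < 0 := EReal.coe_lt_coe_iff.1 hb0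
  have hint : ∀ t, (x₀, b / 2) ∈ interior (epi (f t)) := by
    intro t
    rw [mem_interior_iff_mem_nhds]
    have h1 : ∀ᶠ y in 𝓝 x₀, supFun f y < b := hcont.eventually_lt_const hb
    have h2 : ∀ᶠ r in 𝓝 (b / 2), b < r := lt_mem_nhds (by linarith)
    filter_upwards [h1.prod_nhds h2] with p hp
    exact ((le_iSup (fun t => f t p.1) t).trans hp.1.le).trans (EReal.coe_le_coe_iff.2 hp.2.le)
  have hlim : Filter.Tendsto (fun μ : ℝ => μ • x₀ + (1 - μ) • y) (𝓝[>] 0) (𝓝 y) := by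
    have hc : Continuous (fun μ : ℝ => μ • x₀ + (1 - μ) • y) := by fun_prop
    have := (hc.tendsto 0).mono_left (nhdsWithin_le_nhds (s := Ioi 0))
    simpa using this
  refine mem_closure_of_tendsto hlim ?_
  filter_upwards [Ioo_mem_nhdsGT (zero_lt_one : (0 : ℝ) < 1)] with μ hμ
  -- This height does not depend on `t`, so the supremum stays strictly negative.
  have hneg : μ * (b / 2) < 0 := mul_neg_of_pos_of_neg hμ.1 (by linarith)
  refine lt_of_le_of_lt (iSup_le fun t => ?_) (EReal.coe_lt_coe_iff.2 hneg)
  have := interior_subset ((hf t).combo_interior_closure_mem_interior (hint t) (hy t) hμ.1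
    (sub_nonneg.2 hμ.2.le) (add_sub_cancel μ 1))
  simpa [mem_epi] using this

/-- A linear inequality obtained by rescaling: a functional with value `ℓ` and gap `c`, all of whose
multiples with gap at most `ε` have value at most `M`. -/
theorem lt_mul_of_forall_mul_le {c ε ℓ l M : ℝ} (hε : 0 < ε) (hl : 0 < l) (hc : 0 ≤ c)
    (hcl : c < l * ℓ) (h : ∀ s : ℝ, 0 < s → s * c ≤ ε → s * ℓ ≤ M) : ε < l * M := by
  have hℓ : 0 < ℓ := pos_of_mul_pos_right (hc.trans_lt hcl) hl.le
  -- With zero gap every multiple is allowed; otherwise `s = ε / c` uses up the whole gap.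
  rcases hc.eq_or_lt with rfl | hc
  · have h1 := h ((ε + 1) / (l * ℓ)) (by positivity) (by simpa using hε.le)
    have h2 : l * ((ε + 1) / (l * ℓ) * ℓ) = ε + 1 := by field_simp
    nlinarith
  · have h1 := h (ε / c) (by positivity) (by rw [div_mul_cancel₀ _ hc.ne'])
    have h2 : ε < l * (ε / c * ℓ) := by
      rw [show l * (ε / c * ℓ) = ε * (l * ℓ) / c by ring, lt_div_iff₀ hc]
      exact mul_lt_mul_of_pos_left hcl hε
    nlinarith

variable [LocallyConvexSpace ℝ X]

/-- A direction in which the generators are bounded above points into the sublevel sets of all the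
closed hulls. -/
theorem mem_closure_epi_of_generators_le {f : T → X → EReal} (hf : ∀ t, IsConvexFun (f t))
    {x : X} (hx : supFun f x ≤ 0) {ε M l : ℝ} (hε : 0 < ε) (hl : 0 < l) (hlM : l * M ≤ ε) {z : X}
    (hM : ∀ ψ ∈ generators f x ε, ψ z ≤ M) (t : T) :
    (x + l • z, (0 : ℝ)) ∈ closure (epi (f t)) := by
  have hft : f t x ≤ 0 := (le_iSup (fun t => f t x) t).trans hx
  have hxmem : (x, (0 : ℝ)) ∈ epi (f t) := hft
  by_contra hnot
  refine hlM.not_gt ?_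
  by_cases ht : t ∈ properIdx f
  · obtain ⟨ψ, c, hψ, hpos⟩ := exists_affine_minorant_gt (hf t) ht hnot
    rw [map_add, map_smul, smul_eq_mul] at hpos
    have hcx := hψ x 0 (subset_closure hxmem)
    exact lt_mul_of_forall_mul_le (c := -(ψ x + c)) (ℓ := ψ z) hε hl (by linarith) (by linarith)
      fun s hs hsc => hM _ (smul_mem_generators hx ht hψ hs hsc)
  · have hxD : x ∈ effDom (f t) := hft.trans_lt EReal.zero_lt_top
    have hconv : Convex ℝ (effDom (f t)) := by
      have : effDom (f t) = LinearMap.fst ℝ X ℝ '' epi (f t) := by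
        ext y
        constructor
        · intro hy
          obtain ⟨r, hr, -⟩ := EReal.lt_iff_exists_real_btwn.1 (show f t y < ⊤ from hy)
          exact ⟨(y, r), hr.le, rfl⟩
        · rintro ⟨p, hp, rfl⟩
          exact lt_of_le_of_lt hp (EReal.coe_lt_top _)
      rw [this]
      exact Convex.linear_image (hf t) _
    have hnot' : x + l • z ∉ closure (effDom (f t)) := fun h =>
      hnot (mem_closure_epi_of_not_isProper (hf t) ht h 0)
    obtain ⟨ψ, u, hψ, hu⟩ :=
      geometric_hahn_banach_closed_point hconv.closure isClosed_closure hnot'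
    rw [map_add, map_smul, smul_eq_mul] at hu
    have hux := hψ x (subset_closure hxD)
    refine lt_mul_of_forall_mul_le (c := u - ψ x) (ℓ := ψ z) hε hl (by linarith) (by linarith)
      fun s hs hsc => hM (s • ψ) (Or.inr ?_)
    simp only [mem_iUnion]
    refine ⟨t, ht, mem_epsNormal.2 ⟨hxD, fun y hy => ?_⟩⟩
    have h1 := mul_le_mul_of_nonneg_left (hψ y (subset_closure hy)).le hs.le
    simp only [smul_apply, smul_eq_mul, map_sub]
    linarith

/-- Generators come arbitrarily close to `0` at `z`: small multiples of a minorant in the proper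
case, `0` itself otherwise. -/
theorem nonneg_of_generators_le [Nonempty T] {f : T → X → EReal} (hf : ∀ t, IsConvexFun (f t))
    {x : X} (hx : supFun f x ≤ 0) {ε M : ℝ} (hε : 0 < ε) {z : X}
    (hM : ∀ ψ ∈ generators f x ε, ψ z ≤ M) : 0 ≤ M := by
  obtain ⟨t⟩ := ‹Nonempty T›
  have hft : f t x ≤ 0 := (le_iSup (fun t => f t x) t).trans hx
  by_cases ht : t ∈ properIdx f
  · obtain ⟨ψ, c, hψ⟩ := exists_affine_minorant (hf t) ht
    have hlim : ∀ b : ℝ, Filter.Tendsto (fun s : ℝ => s * b) (𝓝[>] 0) (𝓝 0) := by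
      intro b
      have := ((continuous_mul_const b).tendsto 0).mono_left
        (nhdsWithin_le_nhds (s := Ioi (0 : ℝ)))
      simpa using this
    refine le_of_tendsto (hlim (ψ z)) ?_
    filter_upwards [(hlim (-(ψ x + c))).eventually_le_const hε, self_mem_nhdsWithin]
      with s hsc hs
    exact hM _ (smul_mem_generators hx ht hψ hs hsc)
  · refine hM 0 (Or.inr ?_)
    simp only [mem_iUnion]
    exact ⟨t, ht, mem_epsNormal.2 ⟨hft.trans_lt EReal.zero_lt_top, fun y _ => hε.le⟩⟩

theorem normalCone_subset_closure_convexHull_generators {τ : TopologicalSpace (StrongDual ℝ X)}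
    (hτ : IsCompatibleTopology τ) {f : T → X → EReal} (hf : ∀ t, IsConvexFun (f t)) {x₀ : X}
    (h0 : supFun f x₀ < 0) (h0_bot : supFun f x₀ ≠ ⊥) (hcont : ContinuousAt (supFun f) x₀)
    {x : X} (hx : supFun f x ≤ 0) {ε : ℝ} (hε : 0 < ε) :
    normalCone (closure {y | supFun f y < 0}) x ⊆
      closure[τ] (convexHull ℝ (generators f x ε)) := by
  -- An empty supremum is `⊥`, which finiteness at `x₀` rules out.
  have hT : Nonempty T := by
    by_contra hT
    rw [not_nonempty_iff] at hT
    exact h0_bot (iSup_of_empty _)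
  intro φ hφ
  refine @mem_closure_convexHull_of_forall_dual (StrongDual ℝ X) _ _ τ hτ.isTopologicalAddGroup
    hτ.continuousSMul hτ.locallyConvexSpace _ _ fun Φ hΦ M hM => ?_
  obtain ⟨z, hz⟩ := (hτ.continuous_iff Φ).1 hΦ
  simp only [hz] at hM ⊢
  have hM0 := nonneg_of_generators_le hf hx hε hM
  refine le_trans ?_ hM0
  have hl : 0 < ε / (M + 1) := by positivity
  have hlM : ε / (M + 1) * M ≤ ε := by
    rw [div_mul_eq_mul_div, div_le_iff₀ (by positivity)]
    nlinarith
  have h := (mem_normalCone.1 hφ).2 _ (mem_closure_sublevel hf h0 hcont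
    (mem_closure_epi_of_generators_le hf hx hε hl hlM hM))
  rw [add_sub_cancel_left, map_smul, smul_eq_mul] at h
  exact nonpos_of_mul_nonpos_right h hl

end Sublevel

end SublevelCone

open SublevelCone in
theorem mainTheorem6 {X T : Type*} [AddCommGroup X] [Module ℝ X] [TopologicalSpace X]
    [IsTopologicalAddGroup X] [ContinuousSMul ℝ X] [LocallyConvexSpace ℝ X]
    (τ : TopologicalSpace (StrongDual ℝ X)) (hτ : IsCompatibleTopology τ)
    (f : T → X → EReal) (hf : ∀ t, IsConvexFun (f t))
    (hcont : ∃ x₀ : X, supFun f x₀ < 0 ∧ supFun f x₀ ≠ ⊥ ∧ supFun f x₀ ≠ ⊤ ∧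
      ContinuousAt (supFun f) x₀)
    (x : X) (hx : supFun f x ≤ 0) (hx_bot : supFun f x ≠ ⊥) (hx_top : supFun f x ≠ ⊤) :
    (∀ ε : ℝ, 0 < ε →
      normalCone (closure {y | supFun f y < 0}) x =
        recessionCone (closure[τ] (convexHull ℝ (generators f x ε)))) ∧
    normalCone (closure {y | supFun f y < 0}) x =
      ⋂ (ε : ℝ) (_ : 0 < ε), closure[τ] (convexHull ℝ (generators f x ε)) := by
  obtain ⟨x₀, h0, h0_bot, -, hc⟩ := hcont
  have hxC : x ∈ closure {y | supFun f y < 0} := mem_closure_sublevel hf h0 hc fun t =>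
    subset_closure ((le_iSup (fun t => f t x) t).trans hx)
  have hsub : ∀ ε : ℝ, 0 < ε → normalCone (closure {y | supFun f y < 0}) x ⊆
      closure[τ] (convexHull ℝ (generators f x ε)) := fun ε hε =>
    normalCone_subset_closure_convexHull_generators hτ hf h0 h0_bot hc hx hε
  have hzero : (0 : StrongDual ℝ X) ∈ normalCone (closure {y | supFun f y < 0}) x :=
    mem_normalCone.2 ⟨hxC, fun y _ => le_rfl⟩
  refine ⟨fun ε hε => ?_, ?_⟩
  · have hne := Set.Nonempty.mono (hsub ε hε) ⟨0, hzero⟩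
    apply Set.Subset.antisymm
    · refine @subset_recessionCone_of_cone (StrongDual ℝ X) _ _ τ hτ.isTopologicalAddGroup
        hτ.continuousSMul _ _ (convex_convexHull ℝ _) hne (hsub ε hε)
        fun φ hφ t ht => mem_normalCone.2 ⟨hxC, fun y hy => ?_⟩
      exact mul_nonpos_of_nonneg_of_nonpos ht.le ((mem_normalCone.1 hφ).2 y hy)
    · intro d hd
      refine mem_normalCone.2 ⟨hxC, fun y hy => ?_⟩
      by_contra! hpos
      -- The multiple of `d` takes the value `2 * ε + 1` at `y - x`, beyond the bound on the hull.
      have hmem := (recessionCone_of_nonempty hne).1 hd 0 (hsub ε hε hzero)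
        ((2 * ε + 1) / d (y - x)) (by positivity)
      have h := closure_convexHull_generators_subset hτ hε.le hmem y hy
      rw [zero_add, smul_apply, smul_eq_mul, div_mul_cancel₀ _ hpos.ne'] at h
      linarith
  · apply Set.Subset.antisymm
    · exact Set.subset_iInter₂ hsub
    · intro d hd
      rw [Set.mem_iInter₂] at hd
      refine mem_normalCone.2 ⟨hxC, fun y hy => le_of_forall_pos_le_add fun ε hε => ?_⟩
      have h := closure_convexHull_generators_subset hτ (half_pos hε).le
        (hd (ε / 2) (half_pos hε)) y hy
      linarith
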